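/- Let $K$ be an algebraically closed field of characteristic $p>0$, and let $d\ge 1$ be an integer with $p\nmid d+2$. Let $\mathcal F$ be a foliation of degree $d$ on $\mathbb P^2_K$, given by a non-zero projective $1$-form $\omega=A\,dx+B\,dy+C\,dz$ with $A,B,C\in K[x,y,z]$ homogeneous of degree $d+1$, $xA+yB+zC=0$, and finite singular locus $\mathrm{Sing}(\mathcal F)=\{A=B=C=0\}\subset\mathbb P^2_K$. Let $C=\{F=0\}\subset\mathbb P^2_K$ be a reduced (possibly reducible) curve of degree $e\ge 1$ which is $\mathcal F$-invariant, that is, $dF\wedge\omega=F\,\Theta$ for some polynomial $2$-form $\Theta$ on $\mathbb A^3_K$. Then there is a unique polynomial $3$-form $\beta_{\mathcal F,C}$ on $\mathbb A^3_K$ such that $$dF\wedge\omega=F\Bigl(\tfrac{e}{d+2}\,d\omega+i_R\,\beta_{\mathcal F,C}\Bigr),\qquad R=x\partial_x+y\partial_y+z\partial_z ;$$ the pair $(\mathcal F,C)$ is called special if $\beta_{\mathcal F,C}=0$. A point $q\in\mathrm{Sing}(\mathcal F)$ is called $p$-reduced if, in suitable affine coordinates $(u,v)$ of $\mathbb P^2_K$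 centred at $q$, the $1$-form defining $\mathcal F$ has linear part $v\,du+\alpha\,u\,dv$ at $q$ with $\alpha\in K\setminus\mathbb F_p$. Suppose that $(\mathcal F,C)$ is special and that every singularity of $\mathcal F$ is $p$-reduced. Then $\mathrm{Sing}(\mathcal F)\subset C$, and $C$ has algebraic multiplicity $m_q(C)=2$ at every $q\in\mathrm{Sing}(\mathcal F)$. -/

import Mathlib

open MvPolynomial

/-- Homogeneous coordinate polynomials on `𝔸³`, with `X 0, X 1, X 2` in the roles of `x, y, z`. -/
abbrev Poly3 (K : Type*) [Field K] := MvPolynomial (Fin 3) K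

/-- Polynomials in two affine coordinates `x = X 0`, `y = X 1`. -/
abbrev Poly2 (K : Type*) [Field K] := MvPolynomial (Fin 2) K

/-- A polynomial `1`-form `A dx + B dy + C dz` on `𝔸³`, given by `(A, B, C)`. -/
abbrev OneForm (K : Type*) [Field K] := Fin 3 → Poly3 K

/-- A polynomial `2`-form `P dy∧dz + Q dz∧dx + R dx∧dy` on `𝔸³`, given by `(P, Q, R)`. -/
abbrev TwoForm (K : Type*) [Field K] := Fin 3 → Poly3 K

/-- A polynomial `3`-form `H dx∧dy∧dz` on `𝔸³`, given by `H`. -/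
abbrev ThreeForm (K : Type*) [Field K] := Poly3 K

/-- The projective plane over `K`. -/
abbrev Plane (K : Type*) [Field K] := Projectivization K (Fin 3 → K)

section Forms

variable {K : Type*} [Field K]

/-- `dF`, for a polynomial function `F`. -/
noncomputable def diff0 (F : Poly3 K) : OneForm K := fun i => pderiv i F

/-- `dω`, for a `1`-form `ω`. -/
noncomputable def diff1 (ω : OneForm K) : TwoForm K :=
  ![pderiv 1 (ω 2) - pderiv 2 (ω 1),
    pderiv 2 (ω 0) - pderiv 0 (ω 2),
    pderiv 0 (ω 1) - pderiv 1 (ω 0)]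

/-- `α ∧ ω`, for `1`-forms `α` and `ω`. -/
noncomputable def wedge11 (α ω : OneForm K) : TwoForm K :=
  ![α 1 * ω 2 - α 2 * ω 1,
    α 2 * ω 0 - α 0 * ω 2,
    α 0 * ω 1 - α 1 * ω 0]

/-- `i_R ω`, the contraction of a `1`-form with `R = x ∂_x + y ∂_y + z ∂_z`. -/
noncomputable def radial1 (ω : OneForm K) : Poly3 K := ∑ i, X i * ω i

/-- `i_R β`, the contraction of a `3`-form with `R = x ∂_x + y ∂_y + z ∂_z`:
`i_R (H dx∧dy∧dz) = H (x dy∧dz + y dz∧dx + z dx∧dy)`. -/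
noncomputable def radial3 (β : ThreeForm K) : TwoForm K := fun i => β * X i

/-- The zero locus in the projective plane of a polynomial, used for homogeneous ones (where
the choice of the representative of the point is irrelevant). -/
def zeroLocus3 (F : Poly3 K) : Set (Plane K) := {q | eval q.rep F = 0}

end Forms

/-- A foliation of degree `d` on the projective plane, given by a projective `1`-form: non-zero,
homogeneous coefficients of degree `d + 1`, killed by the radial field, and with only
finitely many singular points. -/
structure PlaneFoliation (K : Type*) [Field K] (d : ℕ) where
  form : OneForm K
  ne_zero : form ≠ 0
  isHomogeneous : ∀ i, (form i).IsHomogeneous (d + 1)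
  radial : radial1 form = 0
  finite_sing : (⋂ i, zeroLocus3 (form i)).Finite

/-- The singular locus `𝒵(A, B, C)` of a foliation given by `A dx + B dy + C dz`. -/
def PlaneFoliation.sing {K : Type*} [Field K] {d : ℕ} (F : PlaneFoliation K d) : Set (Plane K) :=
  ⋂ i, zeroLocus3 (F.form i)

/-- A reduced curve of degree `e ≥ 1` in the projective plane (possibly reducible). -/
structure PlaneCurve (K : Type*) [Field K] (e : ℕ) where
  eqn : Poly3 K
  deg_pos : 0 < e
  isHomogeneous : eqn.IsHomogeneous e
  reduced : Squarefree eqn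

/-- The set of points of a plane curve. -/
def PlaneCurve.points {K : Type*} [Field K] {e : ℕ} (C : PlaneCurve K e) : Set (Plane K) :=
  zeroLocus3 C.eqn

section Special

variable {K : Type*} [Field K] {d e : ℕ}

/-- The curve `C = {F = 0}` is invariant by the foliation given by `ω`: there is a `2`-form `Θ`
with `dF ∧ ω = F Θ`. -/
def IsInvariantCurve (F : PlaneFoliation K d) (C : PlaneCurve K e) : Prop :=
  ∃ Θ : TwoForm K, wedge11 (diff0 C.eqn) F.form = C.eqn • Θ

/-- For a curve `{F = 0}` of degree `e`, invariant by a foliation of degree `d` given by `ω`, and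
if `d + 2 ≠ 0` in `K`, there is a unique `3`-form `β` with
`dF ∧ ω = F ((e / (d + 2)) dω + i_R β)`. -/
theorem existsUnique_beta (hd : ((d + 2 : ℕ) : K) ≠ 0) (F : PlaneFoliation K d)
    (C : PlaneCurve K e) (hC : IsInvariantCurve F C) :
    ∃! β : ThreeForm K, wedge11 (diff0 C.eqn) F.form =
      C.eqn • (((e : K) / ((d + 2 : ℕ) : K)) • diff1 F.form + radial3 β) := by
  obtain ⟨Θ, hΘ⟩ := hC
  have hF0 : C.eqn ≠ 0 := C.reduced.ne_zero
  set G := C.eqn with hG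
  set ω := F.form with hω
  set c : K := (e : K) / ((d + 2 : ℕ) : K) with hc
  have hce : (MvPolynomial.C c : Poly3 K) * ((d : Poly3 K) + 2) = (e : Poly3 K) := by
    have : c * ((d + 2 : ℕ) : K) = (e : K) := div_mul_cancel₀ _ hd
    have h2 := congrArg (MvPolynomial.C (σ := Fin 3)) this
    rw [map_mul, map_natCast, map_natCast] at h2
    push_cast at h2
    exact h2
  have hEG : X 0 * pderiv 0 G + X 1 * pderiv 1 G + X 2 * pderiv 2 G = (e : Poly3 K) * G := by
    have := C.isHomogeneous.sum_X_mul_pderiv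
    simpa [Fin.sum_univ_three] using this
  have hE : ∀ i, X 0 * pderiv 0 (ω i) + X 1 * pderiv 1 (ω i) + X 2 * pderiv 2 (ω i)
      = ((d : Poly3 K) + 1) * ω i := by
    intro i
    have := (F.isHomogeneous i).sum_X_mul_pderiv
    simpa [Fin.sum_univ_three] using this
  have hR : X 0 * ω 0 + X 1 * ω 1 + X 2 * ω 2 = 0 := by
    have := F.radial
    simpa [radial1, Fin.sum_univ_three] using this
  have hR0 := congrArg (pderiv 0) hR
  have hR1 := congrArg (pderiv 1) hR
  have hR2 := congrArg (pderiv 2) hR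
  simp only [map_add, Derivation.leibniz, smul_eq_mul, pderiv_X, Pi.single_apply,
    map_zero] at hR0 hR1 hR2
  simp only [Fin.reduceEq, reduceIte, mul_zero, mul_one, add_zero] at hR0 hR1 hR2
  have h0 := congrFun hΘ 0
  have h1 := congrFun hΘ 1
  have h2 := congrFun hΘ 2
  simp only [wedge11, diff0, Pi.smul_apply, smul_eq_mul, Matrix.cons_val_zero,
    Matrix.cons_val_one, Matrix.cons_val] at h0 h1 h2
  set σ : TwoForm K := Θ - c • diff1 ω with hσ
  have s0 : σ 0 = Θ 0 - MvPolynomial.C c * (pderiv 1 (ω 2) - pderiv 2 (ω 1)) := by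
    simp only [hσ, diff1, Pi.sub_apply, Pi.smul_apply, MvPolynomial.smul_eq_C_mul]
    rfl
  have s1 : σ 1 = Θ 1 - MvPolynomial.C c * (pderiv 2 (ω 0) - pderiv 0 (ω 2)) := by
    simp only [hσ, diff1, Pi.sub_apply, Pi.smul_apply, MvPolynomial.smul_eq_C_mul]
    rfl
  have s2 : σ 2 = Θ 2 - MvPolynomial.C c * (pderiv 0 (ω 1) - pderiv 1 (ω 0)) := by
    simp only [hσ, diff1, Pi.sub_apply, Pi.smul_apply, MvPolynomial.smul_eq_C_mul]
    rfl
  have t01 : X 0 * σ 1 = X 1 * σ 0 := by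
    apply mul_left_cancel₀ hF0
    rw [s0, s1]
    linear_combination (-X 0) * h1 + X 1 * h0 + pderiv 2 G * hR - ω 2 * hEG
      - G * MvPolynomial.C c * (hR2 - hE 2) + G * ω 2 * hce
  have t20 : X 2 * σ 0 = X 0 * σ 2 := by
    apply mul_left_cancel₀ hF0
    rw [s2, s0]
    linear_combination (-X 2) * h0 + X 0 * h2 + pderiv 1 G * hR - ω 1 * hEG
      - G * MvPolynomial.C c * (hR1 - hE 1) + G * ω 1 * hce
  have hdvd : (X 0 : Poly3 K) ∣ σ 0 := by
    have h : (X 0 : Poly3 K) ∣ X 1 * σ 0 := ⟨σ 1, t01.symm⟩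
    rcases X_dvd_mul_iff.mp h with h | h
    · rw [X_dvd_X] at h
      simp at h
    · exact h
  obtain ⟨H, hH⟩ := hdvd
  have hX : ∀ i : Fin 3, (X i : Poly3 K) ≠ 0 := fun i => X_ne_zero i
  have e1 : σ 1 = X 1 * H := by
    apply mul_left_cancel₀ (hX 0)
    rw [t01, hH]; ring
  have e2 : σ 2 = X 2 * H := by
    apply mul_left_cancel₀ (hX 0)
    rw [← t20, hH]; ring
  have hrad : σ = radial3 H := by
    funext i
    fin_cases i
    · simpa [radial3, mul_comm] using hH
    · simpa [radial3, mul_comm] using e1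
    · simpa [radial3, mul_comm] using e2
  have hΘσ : c • diff1 ω + radial3 H = Θ := by
    rw [← hrad, hσ]; abel
  refine ⟨H, ?_, ?_⟩
  · show _ = G • (c • diff1 ω + radial3 H)
    rw [hΘσ, hΘ]
  · intro H' hH'
    change wedge11 (diff0 G) ω = G • (c • diff1 ω + radial3 H') at hH'
    rw [hΘ] at hH'
    have := congrFun hH' 0
    have := mul_left_cancel₀ hF0 this
    rw [← hΘσ] at this
    have : H * X 0 = H' * X 0 := by simpa [radial3] using this
    exact (mul_right_cancel₀ (hX 0) this).symm

/-- The `3`-form `β_{ℱ,C}` attached to a foliation and an invariant curve. -/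
noncomputable def betaForm (hd : ((d + 2 : ℕ) : K) ≠ 0) (F : PlaneFoliation K d)
    (C : PlaneCurve K e) (hC : IsInvariantCurve F C) : ThreeForm K :=
  (existsUnique_beta hd F C hC).choose

/-- The pair `(ℱ, C)` is special: `C` is `ℱ`-invariant and `β_{ℱ,C} = 0`. -/
def IsSpecialPair (hd : ((d + 2 : ℕ) : K) ≠ 0) (F : PlaneFoliation K d)
    (C : PlaneCurve K e) : Prop :=
  ∃ hC : IsInvariantCurve F C, betaForm hd F C hC = 0

end Special

section Local

variable {K : Type*} [Field K] {d e : ℕ}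

/-- The affine coordinates `(x, y) ↦ [A (x, y, 1)]` are centred at `q`. -/
def IsCentredAt (A : GL (Fin 3) K) (q : Plane K) : Prop :=
  (A : Matrix (Fin 3) (Fin 3) K).mulVec ![0, 0, 1] ∈ q.submodule

/-- Every point is the centre of affine coordinates. -/
theorem exists_isCentredAt (q : Plane K) : ∃ A : GL (Fin 3) K, IsCentredAt A q := by
  have key : ∃ M : Matrix (Fin 3) (Fin 3) K, M.det ≠ 0 ∧ M.mulVec ![0, 0, 1] = q.rep := by
    by_cases h0 : q.rep 0 ≠ 0
    · refine ⟨!![0, 0, q.rep 0; 1, 0, q.rep 1; 0, 1, q.rep 2], ?_, ?_⟩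
      · simpa [Matrix.det_fin_three] using h0
      · funext i; fin_cases i <;> simp [Matrix.mulVec, dotProduct, Fin.sum_univ_three]
    by_cases h1 : q.rep 1 ≠ 0
    · refine ⟨!![1, 0, q.rep 0; 0, 0, q.rep 1; 0, 1, q.rep 2], ?_, ?_⟩
      · simpa [Matrix.det_fin_three] using h1
      · funext i; fin_cases i <;> simp [Matrix.mulVec, dotProduct, Fin.sum_univ_three]
    by_cases h2 : q.rep 2 ≠ 0
    · refine ⟨!![1, 0, q.rep 0; 0, 1, q.rep 1; 0, 0, q.rep 2], ?_, ?_⟩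
      · simpa [Matrix.det_fin_three] using h2
      · funext i; fin_cases i <;> simp [Matrix.mulVec, dotProduct, Fin.sum_univ_three]
    push Not at h0 h1 h2
    exfalso
    apply q.rep_nonzero
    funext i; fin_cases i
    · exact h0
    · exact h1
    · exact h2
  obtain ⟨M, hM, hv⟩ := key
  refine ⟨Matrix.GeneralLinearGroup.mkOfDetNeZero M hM, ?_⟩
  show M.mulVec _ ∈ _
  rw [hv, Projectivization.submodule_eq]
  exact Submodule.mem_span_singleton_self _

/-- The components of the map `𝔸² → 𝔸³`, `(x, y) ↦ A (x, y, 1)`. -/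
noncomputable def affineChart (A : GL (Fin 3) K) (j : Fin 3) : Poly2 K :=
  C (A j 0) * X 0 + C (A j 1) * X 1 + C (A j 2)

/-- The function `F (A (x, y, 1))`, the local equation of `{F = 0}` in affine coordinates. -/
noncomputable def localFunction (A : GL (Fin 3) K) (F : Poly3 K) : Poly2 K :=
  aeval (affineChart A) F

/-- The restriction `a dx + b dy` of a `1`-form to the affine coordinates given by `A`, that is,
its pull-back by `(x, y) ↦ A (x, y, 1)`; the value is `(a, b)`. -/
noncomputable def localForm (A : GL (Fin 3) K) (ω : OneForm K) : Fin 2 → Poly2 K :=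
  fun k => ∑ j, aeval (affineChart A) (ω j) * pderiv k (affineChart A j)

/-- The singular point `q` of the foliation is `p`-reduced: in some affine coordinates `(x, y)`
centred at `q` the linear part of the foliation is `y dx + α x dy` with `α ∉ 𝔽_p`. -/
def IsPReducedAt (p : ℕ) [CharP K p] (F : PlaneFoliation K d) (q : Plane K) : Prop :=
  q ∈ F.sing ∧ ∃ A : GL (Fin 3) K, IsCentredAt A q ∧
    ∃ α : K, α ∉ (ZMod.castHom (dvd_refl p) K).range ∧
      homogeneousComponent 1 (localForm A F.form 0) = X 1 ∧
      homogeneousComponent 1 (localForm A F.form 1) = C α * X 0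

/-- `m_q(C) = m`: the local equation of `C` in affine coordinates centred at `q` has order `m`
at the origin. The order is the same for all such coordinates, which exist; it is asked for
all of them. -/
def PlaneCurve.HasMultiplicityAt (C : PlaneCurve K e) (q : Plane K) (m : ℕ) : Prop :=
  ∀ A : GL (Fin 3) K, IsCentredAt A q →
    ((localFunction A C.eqn : Poly2 K) : MvPowerSeries (Fin 2) K).order = (m : ℕ∞)

end Local

/-! In an affine chart centred at a singular point `q`, write `ω = a dx + b dy`, let `f` be the
local equation of the curve and `v = b ∂_x - a ∂_y`. Speciality becomes `v(f) = c f (b_x - a_y)`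
with `c = e/(d+2)`, an element of `𝔽_p`. The multiplicity is squeezed from both sides.

Upper bound: the `p`-curvature `Δ = ω(v^p)` is divisible by every squarefree invariant `f`
(`dvd_pCurvature`). Since `v` has linear part `α x ∂_x - y ∂_y`, `Δ` starts with `(α^p - α) xy`,
which is non-zero because `α ∉ 𝔽_p`. So `f` has order at most `2`.

Lower bound: a term `x^i y^j` of lowest degree in `f` satisfies `α i - j = c (α - 1)`
(`exponent_eq_of_special`), and `α ∉ 𝔽_p` forces `i = j = c` in `K`. If `c ≠ 0`, both exponents are
positive and the order is at least `2`.

If `c = 0`, then `p ∣ e` and `v(f) = 0`; as `Δ ≠ 0`, this gives `df = 0`, impossible for a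
squarefree form of degree at least `2`. Finally, multiplicity `2` at `q` implies that `q` lies on
the curve. -/

/-! ### Derivations in characteristic `p` and squarefree polynomials. -/

section Derivations

variable {R A : Type*} [CommRing R] [CommRing A] [Algebra R A]

/-- The Leibniz rule for iterates of a derivation. -/
theorem Derivation.iterate_mul (D : Derivation R A A) (n : ℕ) (f g : A) :
    D^[n] (f * g) = ∑ ij ∈ Finset.HasAntidiagonal.antidiagonal n, n.choose ij.1 • (D^[ij.1] f * D^[ij.2] g) := by
  induction n with
  | zero => simp
  | succ n ih =>
    rw [Finset.sum_antidiagonal_choose_succ_nsmul (fun i j => D^[i] f * D^[j] g) n,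
      Function.iterate_succ_apply', ih, map_sum, ← Finset.sum_add_distrib]
    refine Finset.sum_congr rfl fun ij hij => ?_
    -- Pascal's rule leaves `n.choose ij.2` in one of the two sums; on the antidiagonal it equals
    -- `n.choose ij.1`.
    have h : n.choose ij.2 = n.choose ij.1 := by
      rw [← Finset.HasAntidiagonal.mem_antidiagonal.mp hij, Nat.choose_symm_add]
    simp only [map_nsmul, Derivation.leibniz, smul_eq_mul, Function.iterate_succ_apply', h,
      ← smul_add]
    ring

/-- In characteristic `p`, the `p`-th iterate of a derivation satisfies the Leibniz rule. -/
theorem Derivation.iterate_char_mul (p : ℕ) [Fact p.Prime] [CharP A p] (D : Derivation R A A)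
    (f g : A) : D^[p] (f * g) = f * D^[p] g + g * D^[p] f := by
  have hp : p ≠ 0 := (Fact.out : p.Prime).ne_zero
  rw [D.iterate_mul, Finset.sum_eq_add (0, p) (p, 0)]
  · simp [mul_comm]
  · simp [Ne.symm hp]
  · rintro ⟨i, j⟩ hij ⟨h0, hp'⟩
    rw [Finset.HasAntidiagonal.mem_antidiagonal] at hij
    simp only [ne_eq, Prod.mk.injEq, not_and] at h0 hp' hij
    have hdvd : p ∣ p.choose i :=
      (Fact.out : p.Prime).dvd_choose_self (by grind) (by grind)
    rw [nsmul_eq_mul, (CharP.cast_eq_zero_iff A p _).mpr hdvd, zero_mul]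
  · simp
  · simp

/-- The `p`-th iterate of a derivation in characteristic `p`. -/
def Derivation.iterateChar (p : ℕ) [Fact p.Prime] [CharP A p] (D : Derivation R A A) :
    Derivation R A A :=
  Derivation.mk' ((D : A →ₗ[R] A) ^ p) fun f g => by
    simpa [Module.End.pow_apply] using D.iterate_char_mul p f g

theorem Derivation.iterateChar_apply (p : ℕ) [Fact p.Prime] [CharP A p] (D : Derivation R A A)
    (f : A) : D.iterateChar p f = D^[p] f := by
  simp [Derivation.iterateChar, Module.End.pow_apply]

theorem Derivation.dvd_iterate {D : Derivation R A A} {f : A} (h : f ∣ D f) (n : ℕ) :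
    f ∣ D^[n] f := by
  induction n with
  | zero => simp
  | succ n ih =>
    obtain ⟨g, hg⟩ := ih
    rw [Function.iterate_succ_apply', hg, Derivation.leibniz, smul_eq_mul, smul_eq_mul]
    exact dvd_add (dvd_mul_right _ _) (h.mul_left _)

end Derivations

/-- A squarefree element divides `h` as soon as all its irreducible divisors do. -/
theorem Squarefree.dvd_of_forall_irreducible_dvd {M : Type*} [CommMonoidWithZero M]
    [UniqueFactorizationMonoid M] {f h : M} (hf : Squarefree f)
    (key : ∀ P, Irreducible P → P ∣ f → P ∣ h) : f ∣ h := by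
  induction f using UniqueFactorizationMonoid.induction_on_prime with
  | h₁ =>
    rcases subsingleton_or_nontrivial M with hM | hM
    · rw [Subsingleton.elim h 0]
    · exact absurd rfl hf.ne_zero
  | h₂ u hu => exact hu.dvd
  | h₃ a P ha hP ih =>
    obtain ⟨k, rfl⟩ := ih (hf.squarefree_of_dvd (dvd_mul_left a P))
      fun Q hQ hQa => key Q hQ (hQa.mul_left P)
    rcases hP.dvd_or_dvd (key P hP.irreducible (dvd_mul_right P a)) with h | h
    · exact absurd (hf P (mul_dvd_mul_left P h)) hP.not_isUnit
    · rw [mul_comm P a]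
      exact mul_dvd_mul_left a h

namespace MvPolynomial

variable {σ K : Type*} [Field K]

theorem derivation_apply_eq_sum [Fintype σ] (D : Derivation K (MvPolynomial σ K) (MvPolynomial σ K))
    (f : MvPolynomial σ K) : D f = ∑ i, D (X i) * pderiv i f := by
  classical
  induction f using MvPolynomial.induction_on with
  | C a => simp [← algebraMap_eq]
  | add p q hp hq => simp only [map_add, hp, hq, mul_add, Finset.sum_add_distrib]
  | mul_X p j hp =>
    simp only [Derivation.leibniz, hp, smul_eq_mul, mul_add, Finset.sum_add_distrib, pderiv_X,
      Pi.single_apply, mul_ite, mul_one, mul_zero, Finset.sum_ite_eq, Finset.mem_univ, if_true,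
      Finset.mul_sum]
    congr 1
    · ring
    · exact Finset.sum_congr rfl fun i _ => by ring

theorem coeff_X_mul_pderiv (i : σ) (f : MvPolynomial σ K) (m : σ →₀ ℕ) :
    coeff m (X i * pderiv i f) = m i * coeff m f := by
  classical
  induction f using MvPolynomial.induction_on' with
  | add p q hp hq => simp only [map_add, mul_add, coeff_add, hp, hq]
  | monomial n a =>
    rw [X_mul_pderiv_monomial, coeff_smul, coeff_monomial]
    split_ifs with h
    · simp [h]
    · simp

/-- Over a perfect field of characteristic `p`, a polynomial all of whose partial derivatives
vanish is a `p`-th power. -/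
theorem exists_pow_eq_of_pderiv_eq_zero (p : ℕ) [Fact p.Prime] [CharP K p] [PerfectRing K p]
    {f : MvPolynomial σ K} (hf : ∀ i, pderiv i f = 0) : ∃ g, g ^ p = f := by
  have hdvd : ∀ m ∈ f.support, ∀ i, p ∣ m i := by
    intro m hm i
    have h := coeff_X_mul_pderiv i f m
    rw [hf, mul_zero, coeff_zero, eq_comm, mul_eq_zero] at h
    exact (CharP.cast_eq_zero_iff K p _).mp (h.resolve_right (mem_support_iff.mp hm))
  -- The root is taken termwise, since Frobenius is additive: exponents are divided by `p`,
  -- coefficients replaced by their `p`-th roots.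
  refine ⟨∑ m ∈ f.support, monomial (m.mapRange (· / p) (Nat.zero_div p))
    ((frobeniusEquiv K p).symm (coeff m f)), ?_⟩
  rw [sum_pow_char p]
  conv_rhs => rw [f.as_sum]
  refine Finset.sum_congr rfl fun m hm => ?_
  rw [monomial_pow]
  congr 1
  · have h : p • m.mapRange (· / p) (Nat.zero_div p) = m := by
      ext i
      simpa using Nat.mul_div_cancel' (hdvd m hm i)
    rw [h]
  · exact frobeniusEquiv_symm_pow_p K p _

/-- A partial derivative has smaller total degree unless it is zero, so divisibility forces `dP =
0`, and then `P` is a `p`-th power. -/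
theorem not_forall_dvd_pderiv (p : ℕ) [Fact p.Prime] [CharP K p] [PerfectRing K p]
    {P : MvPolynomial σ K} (hP : Irreducible P) : ¬ ∀ i, P ∣ pderiv i P := by
  intro h
  have hp := (Fact.out : p.Prime)
  have hz : ∀ i, pderiv i P = 0 := by
    intro i
    by_contra hne
    obtain ⟨m, hm, hdeg⟩ := Finset.exists_mem_eq_sup _ (support_nonempty.mpr hne)
      fun s => s.sum fun _ e => e
    have h1 := totalDegree_le_of_dvd_of_isDomain (h i) hne
    have h2 : coeff (m + Finsupp.single i 1) P ≠ 0 := by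
      intro h0
      rw [mem_support_iff, coeff_pderiv, h0, zero_mul] at hm
      exact hm rfl
    have h3 := le_totalDegree (mem_support_iff.mpr h2)
    rw [totalDegree.eq_1 (pderiv i P), hdeg] at h1
    have h4 : ((m + Finsupp.single i 1).sum fun _ e => e) = (m.sum fun _ e => e) + 1 := by
      classical
      rw [Finsupp.sum_add_index' (by simp) (by simp)]
      simp
    lia
  obtain ⟨g, hg⟩ := exists_pow_eq_of_pderiv_eq_zero p hz
  exact not_irreducible_pow hp.ne_one (hg ▸ hP)

/-- For an irreducible factor, `f = P g`, one has `∂_i f ≡ g ∂_i P` modulo `P`. Here `P ∤ g`, and `P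
∤ ∂_i P` for some `i`, so `P ∣ h`. -/
theorem dvd_of_squarefree_of_forall_dvd_mul_pderiv (p : ℕ) [Fact p.Prime] [CharP K p]
    [PerfectRing K p] {f h : MvPolynomial σ K} (hf : Squarefree f)
    (hd : ∀ i, f ∣ h * pderiv i f) : f ∣ h := by
  have key : ∀ P, Irreducible P → P ∣ f → P ∣ h := by
    rintro P hP ⟨g, rfl⟩
    obtain ⟨i, hi⟩ := not_forall.mp (not_forall_dvd_pderiv p hP)
    have hg : ¬ P ∣ g := fun hg => hP.not_isUnit (hf P (mul_dvd_mul_left P hg))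
    have h1 : P ∣ h * (g * pderiv i P) := by
      have h2 := (dvd_mul_right P g).trans (hd i)
      rw [Derivation.leibniz, smul_eq_mul, smul_eq_mul, mul_add] at h2
      exact (dvd_add_right ⟨h * pderiv i g, by ring⟩).mp h2
    rcases hP.prime.dvd_or_dvd h1 with h1 | h1
    · exact h1
    · rcases hP.prime.dvd_or_dvd h1 with h1 | h1
      · exact absurd h1 hg
      · exact absurd h1 hi
  exact hf.dvd_of_forall_irreducible_dvd key

end MvPolynomial
-- Order of vanishing at the origin, as membership in powers of `idealOfVars`.
namespace MvPolynomial

variable {σ K : Type*} [Field K]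

theorem sub_mem_idealOfVars_sq {a b : MvPolynomial σ K} (h0 : constantCoeff a = constantCoeff b)
    (h1 : homogeneousComponent 1 a = homogeneousComponent 1 b) : a - b ∈ idealOfVars σ K ^ 2 := by
  rw [mem_pow_idealOfVars_iff']
  intro x hx
  rw [coeff_sub, sub_eq_zero]
  rcases Nat.lt_or_ge x.degree 1 with h | h
  · have hx0 : x = 0 := (Finsupp.degree_eq_zero_iff x).mp (by lia)
    subst hx0
    exact h0
  · have hx1 : x.degree = 1 := by lia
    simpa [coeff_homogeneousComponent, hx1] using congrArg (coeff x) h1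

theorem pderiv_mem_pow_idealOfVars {n : ℕ} {f : MvPolynomial σ K} (i : σ)
    (hf : f ∈ idealOfVars σ K ^ (n + 1)) : pderiv i f ∈ idealOfVars σ K ^ n := by
  rw [mem_pow_idealOfVars_iff'] at hf ⊢
  intro x hx
  rw [coeff_pderiv, hf _ (by simpa using hx), zero_mul]

theorem mul_pderiv_mem_pow_idealOfVars {n k : ℕ} {f g : MvPolynomial σ K} (i : σ)
    (hg : g ∈ idealOfVars σ K ^ (k + 1)) (hf : f ∈ idealOfVars σ K ^ n) :
    g * pderiv i f ∈ idealOfVars σ K ^ (n + k) := by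
  cases n with
  | zero =>
    -- With `n = 0` there is no order for the derivative to lose; `g` alone suffices.
    exact Ideal.mul_mem_right _ _ (Ideal.pow_le_pow_right (by lia) hg)
  | succ n =>
    have h := Ideal.mul_mem_mul hg (pderiv_mem_pow_idealOfVars i hf)
    rw [← pow_add] at h
    convert h using 2
    ring

theorem X_mem_idealOfVars (i : σ) : (X i : MvPolynomial σ K) ∈ idealOfVars σ K :=
  Ideal.subset_span ⟨i, rfl⟩

end MvPolynomial

/-! ### The `p`-curvature and the local argument at a `p`-reduced singularity. -/

section PlaneVectorField

variable {K : Type*} [Field K] (p : ℕ) [Fact p.Prime] [CharP K p]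

/-- The vector field `b ∂_x - a ∂_y`, which spans the kernel of `a dx + b dy`. -/
noncomputable def kernelField (a b : Poly2 K) : Derivation K (Poly2 K) (Poly2 K) :=
  b • pderiv 0 - a • pderiv 1

theorem kernelField_apply (a b f : Poly2 K) :
    kernelField a b f = b * pderiv 0 f - a * pderiv 1 f := rfl

/-- The `p`-curvature of `a dx + b dy`: the contraction with the `p`-th power of the vector field
`b ∂_x - a ∂_y`. -/
noncomputable def pCurvature (a b : Poly2 K) : Poly2 K :=
  a * (kernelField a b)^[p] (X 0) + b * (kernelField a b)^[p] (X 1)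

/-- The `p`-th iterate is again a derivation, hence determined by its values on the coordinates. -/
theorem kernelField_iterate_char (a b f : Poly2 K) : (kernelField a b)^[p] f =
    (kernelField a b)^[p] (X 0) * pderiv 0 f + (kernelField a b)^[p] (X 1) * pderiv 1 f := by
  have h := derivation_apply_eq_sum ((kernelField a b).iterateChar p) f
  simpa [Derivation.iterateChar_apply, Fin.sum_univ_two] using h

/-- Cramer's rule: `v(f)` and `v^p(f)` are linear in the partial derivatives of `f`, and the
determinant of the system is the `p`-curvature. -/
theorem pCurvature_mul_pderiv_zero (a b f : Poly2 K) : pCurvature p a b * pderiv 0 f =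
    a * (kernelField a b)^[p] f + (kernelField a b)^[p] (X 1) * kernelField a b f := by
  rw [kernelField_iterate_char p a b f, pCurvature, kernelField_apply a b f]
  ring

theorem pCurvature_mul_pderiv_one (a b f : Poly2 K) : pCurvature p a b * pderiv 1 f =
    b * (kernelField a b)^[p] f - (kernelField a b)^[p] (X 0) * kernelField a b f := by
  rw [kernelField_iterate_char p a b f, pCurvature, kernelField_apply a b f]
  ring

/-- Squarefree invariant curves divide the `p`-curvature. -/
theorem dvd_pCurvature [PerfectRing K p] {a b f : Poly2 K} (hf : Squarefree f)
    (h : f ∣ kernelField a b f) : f ∣ pCurvature p a b := by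
  refine dvd_of_squarefree_of_forall_dvd_mul_pderiv p hf fun i => ?_
  have hp := Derivation.dvd_iterate h p
  fin_cases i
  · simpa [pCurvature_mul_pderiv_zero] using dvd_add (hp.mul_left _) (h.mul_left _)
  · simpa [pCurvature_mul_pderiv_one] using dvd_sub (hp.mul_left _) (h.mul_left _)

/-- First integrals of a vector field with non-zero `p`-curvature have zero differential. -/
theorem pderiv_eq_zero_of_kernelField_eq_zero {a b f : Poly2 K} (hΔ : pCurvature p a b ≠ 0)
    (h : kernelField a b f = 0) (i : Fin 2) : pderiv i f = 0 := by
  have hp : (kernelField a b)^[p] f = 0 := by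
    obtain ⟨n, hn⟩ := Nat.exists_eq_succ_of_ne_zero (Fact.out : p.Prime).ne_zero
    rw [hn, Function.iterate_succ_apply, h]
    exact iterate_map_zero _ n
  refine (mul_eq_zero.mp ?_).resolve_left hΔ
  fin_cases i
  · simpa [hp, h] using pCurvature_mul_pderiv_zero p a b f
  · simpa [hp, h] using pCurvature_mul_pderiv_one p a b f

variable {α : K} {a b : Poly2 K}

theorem kernelField_mem_pow_idealOfVars (ha : a ∈ idealOfVars (Fin 2) K)
    (hb : b ∈ idealOfVars (Fin 2) K) {n : ℕ} {f : Poly2 K} (hf : f ∈ idealOfVars (Fin 2) K ^ n) :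
    kernelField a b f ∈ idealOfVars (Fin 2) K ^ n :=
  Ideal.sub_mem _ (mul_pderiv_mem_pow_idealOfVars (k := 0) 0 (by simpa using hb) hf)
    (mul_pderiv_mem_pow_idealOfVars (k := 0) 1 (by simpa using ha) hf)

/-- Eigenvectors of the linear part of a vector field, iterated. -/
theorem kernelField_iterate_sub_mem (ha : a ∈ idealOfVars (Fin 2) K)
    (hb : b ∈ idealOfVars (Fin 2) K) {g : Poly2 K} {r : K}
    (hg : kernelField a b g - C r * g ∈ idealOfVars (Fin 2) K ^ 2) (n : ℕ) :
    (kernelField a b)^[n] g - C (r ^ n) * g ∈ idealOfVars (Fin 2) K ^ 2 := by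
  induction n with
  | zero => simp
  | succ n ih =>
    have h1 := kernelField_mem_pow_idealOfVars ha hb ih
    have h2 := Ideal.add_mem _ h1 (Ideal.mul_mem_left _ (C (r ^ n)) hg)
    convert h2 using 1
    rw [Function.iterate_succ_apply', map_sub, C_mul', C_mul', Derivation.map_smul, C_mul', C_mul',
      smul_sub, smul_smul, pow_succ]
    abel

theorem mem_idealOfVars_of_sub_C_mul_X_mem {σ : Type*} {g : MvPolynomial σ K} {r : K} {i : σ}
    (hg : g - C r * X i ∈ idealOfVars σ K ^ 2) : g ∈ idealOfVars σ K := by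
  simpa using Ideal.add_mem _ (Ideal.pow_le_self two_ne_zero hg)
    (Ideal.mul_mem_left _ (C r) (X_mem_idealOfVars i))

/-- The leading term of the `p`-curvature at a singularity with linear part `y dx + α x dy`. -/
theorem pCurvature_sub_mem (ha : a - C 1 * X 1 ∈ idealOfVars (Fin 2) K ^ 2)
    (hb : b - C α * X 0 ∈ idealOfVars (Fin 2) K ^ 2) :
    pCurvature p a b - C (α ^ p - α) * (X 0 * X 1) ∈ idealOfVars (Fin 2) K ^ 3 := by
  have ha' := mem_idealOfVars_of_sub_C_mul_X_mem ha
  have hb' := mem_idealOfVars_of_sub_C_mul_X_mem hb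
  have h0 := kernelField_iterate_sub_mem ha' hb' (g := X 0) (r := α)
    (by simpa [kernelField_apply] using hb) p
  have h1 := kernelField_iterate_sub_mem ha' hb' (g := X 1) (r := -1)
    (by
      have h := (idealOfVars (Fin 2) K ^ 2).neg_mem ha
      simp only [kernelField_apply, pderiv_X, Pi.single_apply]
      convert h using 1
      simp [sub_eq_add_neg, add_comm]) p
  -- Also true for `p = 2`, where `-1 = 1`.
  have hp1 : (-1 : K) ^ p = -1 := by
    simpa using neg_one_pow_char K p
  rw [hp1] at h1
  have hmul : ∀ {u v : Poly2 K}, u ∈ idealOfVars (Fin 2) K → v ∈ idealOfVars (Fin 2) K ^ 2 →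
      u * v ∈ idealOfVars (Fin 2) K ^ 3 := fun hu hv => by
    rw [pow_succ' _ 2]
    exact Ideal.mul_mem_mul hu hv
  -- With `x = X 0`, `y = X 1`, the difference is `a (v^p x - α^p x) + b (v^p y + y) + α^p x (a - y)
  -- - y (b - α x)`.
  have key := Ideal.add_mem _
    (Ideal.add_mem _ (hmul ha' h0) (hmul hb' h1))
    (Ideal.add_mem _
      (Ideal.mul_mem_left _ (C (α ^ p)) (hmul (X_mem_idealOfVars (0 : Fin 2)) ha))
      (Ideal.mul_mem_left _ (C (-1)) (hmul (X_mem_idealOfVars (1 : Fin 2)) hb)))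
  convert key using 1
  simp only [pCurvature, map_sub, map_neg, map_one]
  ring

theorem pCurvature_notMem (hα : α ^ p ≠ α) (ha : a - C 1 * X 1 ∈ idealOfVars (Fin 2) K ^ 2)
    (hb : b - C α * X 0 ∈ idealOfVars (Fin 2) K ^ 2) :
    pCurvature p a b ∉ idealOfVars (Fin 2) K ^ 3 := by
  intro h
  have h1 := Ideal.sub_mem _ h (pCurvature_sub_mem p ha hb)
  rw [sub_sub_cancel] at h1
  have h2 : C (α ^ p - α) * (X 0 * X 1 : Poly2 K) =
      monomial (Finsupp.single 0 1 + Finsupp.single 1 1) (α ^ p - α) := by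
    rw [X, X, monomial_mul, C_mul_monomial, one_mul, mul_one]
  rw [h2, monomial_mem_pow_idealOfVars_iff _ _ (sub_ne_zero.mpr hα)] at h1
  simp at h1

/-- The equation satisfied by the exponents of the terms of lowest degree of a solution of
`df ∧ ω = c f dω`, if `ω` has linear part `y dx + α x dy`. -/
theorem exponent_eq_of_special (ha : a - C 1 * X 1 ∈ idealOfVars (Fin 2) K ^ 2)
    (hb : b - C α * X 0 ∈ idealOfVars (Fin 2) K ^ 2) {c : K} {f : Poly2 K}
    (hf : kernelField a b f = C c * f * (pderiv 0 b - pderiv 1 a)) {m : Fin 2 →₀ ℕ}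
    (hm : coeff m f ≠ 0) (hord : f ∈ idealOfVars (Fin 2) K ^ m.degree) :
    α * m 0 - m 1 = c * (α - 1) := by
  have h1 := mul_pderiv_mem_pow_idealOfVars (k := 1) 0 hb hord
  have h2 := mul_pderiv_mem_pow_idealOfVars (k := 1) 1 ha hord
  have hmul : ∀ {v : Poly2 K}, v ∈ idealOfVars (Fin 2) K ^ (1 + 1) → ∀ i,
      C c * (f * pderiv i v) ∈ idealOfVars (Fin 2) K ^ (m.degree + 1) := fun hv i => by
    rw [pow_add]
    exact Ideal.mul_mem_left _ _ (Ideal.mul_mem_mul hord (pderiv_mem_pow_idealOfVars i hv))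
  -- Replacing `a` and `b` by their linear parts changes `hf` only in order `m.degree + 1`. The
  -- resulting operator is diagonal on monomials.
  have key : C α * (X 0 * pderiv 0 f) - X 1 * pderiv 1 f - C (c * (α - 1)) * f ∈
      idealOfVars (Fin 2) K ^ (m.degree + 1) := by
    have h := Ideal.sub_mem _ (Ideal.add_mem _ (hmul hb 0) h2) (Ideal.add_mem _ (hmul ha 1) h1)
    convert h using 1
    simp only [kernelField_apply] at hf
    simp only [map_sub, map_mul, map_one, one_mul, pderiv_C_mul, pderiv_X_self]
    linear_combination hf
  have h0 := (mem_pow_idealOfVars_iff' _ _).mp key m (Nat.lt_succ_self _)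
  simp only [coeff_sub, coeff_C_mul, coeff_X_mul_pderiv] at h0
  exact mul_right_cancel₀ hm (by linear_combination h0)

theorem order_eq_two_of_special [PerfectRing K p] (hα : α ^ p ≠ α)
    (ha : a - C 1 * X 1 ∈ idealOfVars (Fin 2) K ^ 2)
    (hb : b - C α * X 0 ∈ idealOfVars (Fin 2) K ^ 2) {c : K} (hc : c ^ p = c) (hc0 : c ≠ 0)
    {f : Poly2 K} (hsq : Squarefree f)
    (hf : kernelField a b f = C c * f * (pderiv 0 b - pderiv 1 a)) :
    (f : MvPowerSeries (Fin 2) K).order = (2 : ℕ) := by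
  have hne : (f : MvPowerSeries (Fin 2) K) ≠ 0 := by simpa using hsq.ne_zero
  obtain ⟨m, hm, hmo⟩ := MvPowerSeries.exists_coeff_ne_zero_and_order
    (MvPowerSeries.ne_zero_iff_order_finite.mp hne)
  rw [coeff_coe] at hm
  have hord : f ∈ idealOfVars (Fin 2) K ^ m.degree := by
    rw [mem_pow_idealOfVars_iff']
    intro x hx
    rw [← coeff_coe]
    exact MvPowerSeries.coeff_of_lt_order (by rw [← hmo]; exact_mod_cast hx)
  have hle : m.degree ≤ 2 := by
    by_contra! h
    obtain ⟨g, hg⟩ := dvd_pCurvature p hsq (a := a) (b := b) 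
      (hf ▸ (dvd_mul_left f (C c)).mul_right _)
    exact pCurvature_notMem p hα ha hb
      (hg ▸ Ideal.mul_mem_right _ _ (Ideal.pow_le_pow_right h hord))
  have hexp := exponent_eq_of_special ha hb hf hm hord
  -- Otherwise `hexp` expresses `α` as a quotient of elements fixed by Frobenius.
  have h0 : (m 0 : K) = c := by
    by_contra h
    refine hα ?_
    have h' : (m 0 : K) - c ≠ 0 := sub_ne_zero.mpr h
    have hα' : α = (m 1 - c) / (m 0 - c) := by
      rw [eq_div_iff h']
      linear_combination hexp
    have hcast : ∀ n : ℕ, (n : K) ^ p = n := map_natCast (frobenius K p)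
    rw [hα', div_pow, sub_pow_char, sub_pow_char, hcast, hcast, hc]
  have h1 : (m 1 : K) = c := by linear_combination α * h0 - hexp
  have hdeg : m.degree = m 0 + m 1 := by
    simp [Finsupp.degree_eq_sum, Fin.sum_univ_two]
  rw [← hmo]
  congr 1
  have hm0 : m.degree ≠ 0 := fun h => hc0 (by
    rw [← h0, (by lia : m 0 = 0), Nat.cast_zero])
  have hm1 : m.degree ≠ 1 := fun h => by
    rcases Nat.eq_zero_or_pos (m 0) with h' | h'
    · exact hc0 (by rw [← h0, h', Nat.cast_zero])
    · exact hc0 (by rw [← h1, (by lia : m 1 = 0), Nat.cast_zero])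
  lia

end PlaneVectorField
-- Passing between ternary forms and their restrictions to `z = 1`.
section Dehomogenization

variable {K : Type*} [Field K]

/-- The dehomogenization `G(x, y, 1)` of a polynomial `G(x, y, z)`. -/
noncomputable def dehomogenize : Poly3 K →ₐ[K] Poly2 K := aeval ![X 0, X 1, 1]

theorem dehomogenize_monomial (s : Fin 3 →₀ ℕ) (r : K) : dehomogenize (monomial s r) =
    monomial (Finsupp.single 0 (s 0) + Finsupp.single 1 (s 1)) r := by
  rw [dehomogenize, aeval_monomial, Finsupp.prod_fintype _ _ (by simp), Fin.prod_univ_three]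
  simp [X_pow_eq_monomial, monomial_mul, C_mul_monomial]

/-- In a fixed degree the exponent of `z` is determined by the other two, so distinct monomials do
not collide. -/
theorem coeff_dehomogenize {n : ℕ} {G : Poly3 K} (hG : G.IsHomogeneous n) {s : Fin 3 →₀ ℕ}
    (hs : s.degree = n) :
    coeff (Finsupp.single 0 (s 0) + Finsupp.single 1 (s 1)) (dehomogenize G) = coeff s G := by
  classical
  conv_lhs => rw [G.as_sum, map_sum, coeff_sum]
  simp only [dehomogenize_monomial, coeff_monomial]
  rw [Finset.sum_eq_single s]
  · simp
  · intro t ht hts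
    refine if_neg fun h => hts ?_
    have h0 := DFunLike.congr_fun h 0
    have h1 := DFunLike.congr_fun h 1
    simp at h0 h1
    have htn : t.degree = n := by
      by_contra h
      exact mem_support_iff.mp ht (hG.coeff_eq_zero h)
    rw [Finsupp.degree_eq_sum, Fin.sum_univ_three] at hs htn
    ext i
    fin_cases i
    · exact h0
    · exact h1
    · change t 2 = s 2
      lia
  · intro h
    simpa using notMem_support_iff.mp h

/-- A homogeneous polynomial of given degree is determined by its dehomogenization. -/
theorem eq_of_dehomogenize_eq {n : ℕ} {G H : Poly3 K} (hG : G.IsHomogeneous n)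
    (hH : H.IsHomogeneous n) (h : dehomogenize G = dehomogenize H) : G = H := by
  ext s
  by_cases hs : s.degree = n
  · rw [← coeff_dehomogenize hG hs, h, coeff_dehomogenize hH hs]
  · rw [hG.coeff_eq_zero hs, hH.coeff_eq_zero hs]

theorem totalDegree_dehomogenize_le {n : ℕ} {G : Poly3 K} (hG : G.IsHomogeneous n) :
    (dehomogenize G).totalDegree ≤ n := by
  rw [G.as_sum, map_sum]
  refine totalDegree_finsetSum_le fun s hs => ?_
  have hsn : s.degree = n := by
    by_contra h
    exact mem_support_iff.mp hs (hG.coeff_eq_zero h)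
  rw [dehomogenize_monomial]
  refine (totalDegree_monomial_le _ _).trans ?_
  rw [Finsupp.degree_eq_sum, Fin.sum_univ_three] at hsn
  change Finsupp.degree _ ≤ n
  simp
  lia

theorem exists_dehomogenize_eq {n : ℕ} {g : Poly2 K} (hg : g.totalDegree ≤ n) :
    ∃ G : Poly3 K, G.IsHomogeneous n ∧ dehomogenize G = g := by
  refine ⟨∑ m ∈ g.support, monomial (Finsupp.single 0 (m 0) + Finsupp.single 1 (m 1) +
    Finsupp.single 2 (n - m.degree)) (coeff m g), ?_, ?_⟩
  · refine IsHomogeneous.sum _ _ _ fun m hm => isHomogeneous_monomial _ ?_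
    have h : m.degree ≤ n := (le_totalDegree hm).trans hg
    have h' := Finsupp.degree_eq_sum m
    rw [Fin.sum_univ_two] at h'
    simp only [map_add, Finsupp.degree_single]
    lia
  · rw [map_sum]
    conv_rhs => rw [g.as_sum]
    refine Finset.sum_congr rfl fun m _ => ?_
    rw [dehomogenize_monomial]
    congr 2
    ext i
    fin_cases i <;> simp

theorem squarefree_dehomogenize {n : ℕ} {G : Poly3 K} (hG : G.IsHomogeneous n)
    (hsq : Squarefree G) : Squarefree (dehomogenize G) := by
  rintro g ⟨h, hgh⟩
  have hne : g * g * h ≠ 0 := by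
    intro h0
    rw [h0, ← map_zero dehomogenize] at hgh
    exact hsq.ne_zero (eq_of_dehomogenize_eq hG (isHomogeneous_zero _ _ n) hgh)
  have hg0 : g * g ≠ 0 := left_ne_zero_of_mul hne
  have hdeg := totalDegree_dehomogenize_le hG
  rw [hgh, totalDegree_mul_of_isDomain hg0 (right_ne_zero_of_mul hne),
    totalDegree_mul_of_isDomain (left_ne_zero_of_mul hg0) (left_ne_zero_of_mul hg0)] at hdeg
  obtain ⟨G₁, hG₁, rfl⟩ := exists_dehomogenize_eq (le_refl g.totalDegree)
  -- The cofactor is homogenized to degree `n - 2 deg g`, possibly above its own, so that it absorbs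
  -- any power of `z` dividing `G`.
  obtain ⟨H, hH, rfl⟩ := exists_dehomogenize_eq (g := h) (Nat.le_sub_of_add_le' hdeg)
  have hGH : G = G₁ * G₁ * H := by
    refine eq_of_dehomogenize_eq hG ?_ (by rw [hgh, map_mul, map_mul])
    have h := (hG₁.mul hG₁).mul hH
    rwa [Nat.add_sub_cancel' (by lia)] at h
  exact (hsq G₁ ⟨H, hGH⟩).map dehomogenize

/-- Order `k` at the origin means that every monomial of `G` has joint degree at least `k` in `x,
y`; what replaces `z` is irrelevant. -/
theorem aeval_mem_pow_idealOfVars {n k : ℕ} {G : Poly3 K} (hG : G.IsHomogeneous n)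
    (hk : dehomogenize G ∈ idealOfVars (Fin 2) K ^ k) {ψ : Fin 3 → Poly2 K}
    (h0 : ψ 0 ∈ idealOfVars (Fin 2) K) (h1 : ψ 1 ∈ idealOfVars (Fin 2) K) :
    aeval ψ G ∈ idealOfVars (Fin 2) K ^ k := by
  rw [G.as_sum, map_sum]
  refine Ideal.sum_mem _ fun s hs => ?_
  have hsn : s.degree = n := by
    by_contra h
    exact mem_support_iff.mp hs (hG.coeff_eq_zero h)
  have hle : k ≤ s 0 + s 1 := by
    have h := (mem_pow_idealOfVars_iff _ _).mp hk _
      (mem_support_iff.mpr ((coeff_dehomogenize hG hsn).trans_ne (mem_support_iff.mp hs)))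
    simpa using h
  rw [aeval_monomial, Finsupp.prod_fintype _ _ (by simp), Fin.prod_univ_three]
  refine Ideal.mul_mem_left _ _ (Ideal.mul_mem_right _ _ (Ideal.pow_le_pow_right hle ?_))
  rw [pow_add]
  exact Ideal.mul_mem_mul (Ideal.pow_mem_pow h0 _) (Ideal.pow_mem_pow h1 _)

/-- The dehomogenization of a squarefree form of degree at least `2` has non-zero differential. -/
theorem exists_pderiv_dehomogenize_ne_zero (p : ℕ) [Fact p.Prime] [CharP K p] [PerfectRing K p]
    {n : ℕ} {G : Poly3 K} (hG : G.IsHomogeneous n) (hn : 2 ≤ n) (hsq : Squarefree G) :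
    ∃ i, pderiv i (dehomogenize G) ≠ 0 := by
  by_contra! h
  obtain ⟨g, hg⟩ := exists_pow_eq_of_pderiv_eq_zero p h
  have hgu : IsUnit g := squarefree_dehomogenize hG hsq g
    (hg ▸ pow_two g ▸ pow_dvd_pow g (Fact.out : p.Prime).two_le)
  obtain ⟨r, hr⟩ : ∃ r : K, dehomogenize G = C r := by
    have hu := hgu.pow p
    rw [hg] at hu
    obtain ⟨r, -, hr⟩ := isUnit_iff_eq_C_of_isReduced.mp hu
    exact ⟨r, hr⟩
  -- A form with constant dehomogenization is a multiple of `z ^ n`, which has a square factor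
  -- because `n ≥ 2`.
  have hGr : G = C r * X 2 ^ n := by
    refine eq_of_dehomogenize_eq hG ?_ ?_
    · simpa using (isHomogeneous_C _ r).mul (isHomogeneous_X_pow (R := K) (2 : Fin 3) n)
    · rw [hr, map_mul, map_pow]
      simp [dehomogenize, ← algebraMap_eq]
  have hX := hsq (X 2) (hGr ▸ (pow_two (X 2 : Poly3 K) ▸ pow_dvd_pow _ hn).mul_left _)
  exact (X_prime (R := K) (i := (2 : Fin 3))).not_isUnit hX

end Dehomogenization
-- Linear changes of homogeneous coordinates.
section LinearSubstitution

variable {K : Type*} [Field K]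

/-- The polynomial `F(A(x, y, z))`. -/
noncomputable def linearSubst (A : Matrix (Fin 3) (Fin 3) K) : Poly3 K →ₐ[K] Poly3 K :=
  aeval fun j => ∑ k, C (A j k) * X k

theorem linearSubst_X (A : Matrix (Fin 3) (Fin 3) K) (j : Fin 3) :
    linearSubst A (X j) = ∑ k, C (A j k) * X k :=
  aeval_X _ _

theorem linearSubst_linearSubst (A B : Matrix (Fin 3) (Fin 3) K) (F : Poly3 K) :
    linearSubst A (linearSubst B F) = linearSubst (B * A) F := by
  suffices h : (linearSubst A).comp (linearSubst B) = linearSubst (B * A) from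
    DFunLike.congr_fun h F
  refine algHom_ext fun j => ?_
  simp only [AlgHom.comp_apply, linearSubst_X, map_sum, map_mul, Matrix.mul_apply, Finset.sum_mul,
    ← algebraMap_eq, AlgHom.commutes, Finset.mul_sum, mul_assoc]
  exact Finset.sum_comm

theorem linearSubst_one (F : Poly3 K) : linearSubst (1 : Matrix (Fin 3) (Fin 3) K) F = F := by
  suffices h : linearSubst (1 : Matrix (Fin 3) (Fin 3) K) = AlgHom.id K _ from
    DFunLike.congr_fun h F
  refine algHom_ext fun j => ?_
  simp [linearSubst_X, Matrix.one_apply]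

theorem linearSubst_inv_linearSubst (A : GL (Fin 3) K) (F : Poly3 K) :
    linearSubst (A⁻¹ : GL (Fin 3) K).val (linearSubst A.val F) = F := by
  rw [linearSubst_linearSubst, ← Units.val_mul, mul_inv_cancel, Units.val_one, linearSubst_one]

theorem linearSubst_isHomogeneous (A : Matrix (Fin 3) (Fin 3) K) {n : ℕ} {F : Poly3 K}
    (hF : F.IsHomogeneous n) : (linearSubst A F).IsHomogeneous n := by
  have h := hF.aeval (fun j => ∑ k, C (A j k) * X k) (n := 1) fun j =>
    IsHomogeneous.sum _ _ _ fun k _ => (isHomogeneous_C_mul_X _ _)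
  rwa [one_mul] at h

theorem squarefree_linearSubst (A : GL (Fin 3) K) {F : Poly3 K} (hF : Squarefree F) :
    Squarefree (linearSubst (A : Matrix (Fin 3) (Fin 3) K) F) := by
  intro G hG
  have h := hF (linearSubst (A⁻¹ : GL (Fin 3) K).val G) (by
    rw [← map_mul]
    conv_rhs => rw [← linearSubst_inv_linearSubst A F]
    exact map_dvd _ hG)
  simpa [inv_inv] using (linearSubst_inv_linearSubst A⁻¹ G) ▸ h.map (linearSubst (A⁻¹⁻¹ : GL (Fin 3) K).val)

theorem dehomogenize_linearSubst (A : GL (Fin 3) K) (F : Poly3 K) :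
    dehomogenize (linearSubst A.val F) = localFunction A F := by
  suffices h : dehomogenize.comp (linearSubst A.val) = aeval (affineChart A) from
    DFunLike.congr_fun h F
  refine algHom_ext fun j => ?_
  simp [linearSubst_X, dehomogenize, affineChart, Fin.sum_univ_three, ← algebraMap_eq]

theorem squarefree_localFunction (A : GL (Fin 3) K) {n : ℕ} {F : Poly3 K}
    (hF : F.IsHomogeneous n) (hsq : Squarefree F) : Squarefree (localFunction A F) := by
  rw [← dehomogenize_linearSubst]
  exact squarefree_dehomogenize (linearSubst_isHomogeneous _ hF) (squarefree_linearSubst A hsq)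

end LinearSubstitution

/-! ### Comparison of affine charts, and the equations restricted to a chart. -/

section Charts

variable {K : Type*} [Field K]

theorem mem_idealOfVars_iff_constantCoeff {σ : Type*} {f : MvPolynomial σ K} :
    f ∈ idealOfVars σ K ↔ constantCoeff f = 0 := by
  rw [← pow_one (idealOfVars σ K), mem_pow_idealOfVars_iff']
  refine ⟨fun h => h 0 (by simp), fun h x hx => ?_⟩
  have hx0 : x = 0 := (Finsupp.degree_eq_zero_iff x).mp (by lia)
  exact hx0 ▸ h

theorem constantCoeff_localFunction (A : GL (Fin 3) K) (F : Poly3 K) :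
    constantCoeff (localFunction A F) = eval (A.val.mulVec ![0, 0, 1]) F := by
  rw [localFunction, ← coe_aeval_eq_eval]
  change ((constantCoeff.comp (aeval (affineChart A)).toRingHom : Poly3 K →+* K)) F = _
  congr 1
  refine ringHom_ext (fun r => ?_) fun j => ?_
  · simp
  · simp [affineChart, Matrix.mulVec, dotProduct, Fin.sum_univ_three]

theorem IsCentredAt.exists_smul_rep {A : GL (Fin 3) K} {q : Plane K} (h : IsCentredAt A q) :
    ∃ t : K, t ≠ 0 ∧ A.val.mulVec ![0, 0, 1] = t • q.rep := by
  rw [IsCentredAt, Projectivization.submodule_eq, Submodule.mem_span_singleton] at h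
  obtain ⟨t, ht⟩ := h
  refine ⟨t, ?_, ht.symm⟩
  rintro rfl
  rw [zero_smul] at ht
  have h := congrArg (A⁻¹ : GL (Fin 3) K).val.mulVec ht
  rw [Matrix.mulVec_mulVec, ← Units.val_mul, inv_mul_cancel, Units.val_one, Matrix.one_mulVec,
    Matrix.mulVec_zero] at h
  simpa using congrFun h 2

theorem eval_smul_eq {n : ℕ} {F : Poly3 K} (hF : F.IsHomogeneous n) (t : K) (x : Fin 3 → K) :
    eval (t • x) F = t ^ n * eval x F := by
  rw [eval_eq, eval_eq, Finset.mul_sum]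
  refine Finset.sum_congr rfl fun s hs => ?_
  have hsn : s.degree = n := by
    by_contra h
    exact mem_support_iff.mp hs (hF.coeff_eq_zero h)
  rw [← hsn, Finsupp.degree_apply]
  simp only [Pi.smul_apply, smul_eq_mul, mul_pow, Finset.prod_mul_distrib, Finset.prod_pow_eq_pow_sum]
  ring

theorem constantCoeff_localFunction_eq_zero_iff {A : GL (Fin 3) K} {q : Plane K}
    (h : IsCentredAt A q) {n : ℕ} {F : Poly3 K} (hF : F.IsHomogeneous n) :
    constantCoeff (localFunction A F) = 0 ↔ q ∈ zeroLocus3 F := by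
  obtain ⟨t, ht, hA⟩ := h.exists_smul_rep
  rw [constantCoeff_localFunction, hA, eval_smul_eq hF, mul_eq_zero]
  exact or_iff_right (pow_ne_zero _ ht)

/-- The transition between charts is fractional linear. Homogeneity avoids denominators: `A⁻¹ B (x,
y, 1)` is substituted into the form `F ∘ A`, and its first two entries vanish at the origin because
both charts are centred at `q`. -/
theorem localFunction_mem_pow_of_isCentredAt {A B : GL (Fin 3) K} {q : Plane K}
    (hA : IsCentredAt A q) (hB : IsCentredAt B q) {n k : ℕ} {F : Poly3 K} (hF : F.IsHomogeneous n)
    (h : localFunction A F ∈ idealOfVars (Fin 2) K ^ k) :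
    localFunction B F ∈ idealOfVars (Fin 2) K ^ k := by
  obtain ⟨t, ht, hAt⟩ := hA.exists_smul_rep
  obtain ⟨u, -, hBu⟩ := hB.exists_smul_rep
  set ψ : Fin 3 → Poly2 K := fun i => localFunction B (∑ j, C ((A⁻¹ : GL (Fin 3) K).val i j) * X j)
    with hψ
  have hc : ∀ i, i ≠ 2 → ψ i ∈ idealOfVars (Fin 2) K := by
    intro i hi
    rw [mem_idealOfVars_iff_constantCoeff, hψ, constantCoeff_localFunction]
    have h1 : B.val.mulVec ![0, 0, 1] = (u / t) • A.val.mulVec ![0, 0, 1] := by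
      rw [hAt, hBu, smul_smul, div_mul_cancel₀ _ ht]
    have h2 : (A⁻¹ : GL (Fin 3) K).val.mulVec (B.val.mulVec ![0, 0, 1]) =
        (u / t) • ![0, 0, 1] := by
      rw [h1, Matrix.mulVec_smul, Matrix.mulVec_mulVec, ← Units.val_mul, inv_mul_cancel,
        Units.val_one, Matrix.one_mulVec]
    have h3 := congrFun h2 i
    simp only [map_sum, map_mul, eval_C, eval_X]
    refine h3.trans ?_
    fin_cases i <;> simp_all
  have hcomp : localFunction B F = aeval ψ (linearSubst A.val F) := by
    have h : aeval ψ = (aeval (affineChart B)).comp (linearSubst (A⁻¹ : GL (Fin 3) K).val) :=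
      algHom_ext fun i => by rw [aeval_X, AlgHom.comp_apply, linearSubst_X]; rfl
    rw [h, AlgHom.comp_apply, linearSubst_inv_linearSubst, localFunction]
  rw [hcomp]
  rw [← dehomogenize_linearSubst] at h
  exact aeval_mem_pow_idealOfVars (linearSubst_isHomogeneous _ hF) h (hc 0 (by decide))
    (hc 1 (by decide))

theorem natCast_le_order_iff {f : Poly2 K} {n : ℕ} :
    (n : ℕ∞) ≤ (f : MvPowerSeries (Fin 2) K).order ↔ f ∈ idealOfVars (Fin 2) K ^ n := by
  rw [mem_pow_idealOfVars_iff']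
  constructor
  · intro h x hx
    rw [← coeff_coe]
    exact MvPowerSeries.coeff_of_lt_order (lt_of_lt_of_le (by exact_mod_cast hx) h)
  · intro h
    exact MvPowerSeries.nat_le_order fun x hx => by rw [coeff_coe, h x hx]

theorem order_localFunction_eq {A B : GL (Fin 3) K} {q : Plane K}
    (hA : IsCentredAt A q) (hB : IsCentredAt B q) {n : ℕ} {F : Poly3 K} (hF : F.IsHomogeneous n) :
    (localFunction A F : MvPowerSeries (Fin 2) K).order =
      (localFunction B F : MvPowerSeries (Fin 2) K).order := by
  refine ENat.eq_of_forall_natCast_le_iff fun k => ?_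
  rw [natCast_le_order_iff, natCast_le_order_iff]
  exact ⟨localFunction_mem_pow_of_isCentredAt hA hB hF, localFunction_mem_pow_of_isCentredAt hB hA hF⟩

theorem pderiv_affineChart_zero (A : GL (Fin 3) K) (j : Fin 3) :
    pderiv 0 (affineChart A j) = C (A j 0) := by
  simp [affineChart, pderiv_X]

theorem pderiv_affineChart_one (A : GL (Fin 3) K) (j : Fin 3) :
    pderiv 1 (affineChart A j) = C (A j 1) := by
  simp [affineChart, pderiv_X]

theorem localForm_zero (A : GL (Fin 3) K) (ω : OneForm K) : localForm A ω 0 =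
    localFunction A (ω 0) * C (A 0 0) + localFunction A (ω 1) * C (A 1 0) +
      localFunction A (ω 2) * C (A 2 0) := by
  simp only [localForm, pderiv_affineChart_zero, Fin.sum_univ_three, localFunction]

theorem localForm_one (A : GL (Fin 3) K) (ω : OneForm K) : localForm A ω 1 =
    localFunction A (ω 0) * C (A 0 1) + localFunction A (ω 1) * C (A 1 1) +
      localFunction A (ω 2) * C (A 2 1) := by
  simp only [localForm, pderiv_affineChart_one, Fin.sum_univ_three, localFunction]

/-- The chain rule: the differential of the local equation is the restriction of the
differential. -/
theorem pderiv_localFunction (A : GL (Fin 3) K) (F : Poly3 K) (k : Fin 2) :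
    pderiv k (localFunction A F) = localForm A (diff0 F) k := by
  simp only [localForm, diff0, localFunction]
  induction F using MvPolynomial.induction_on with
  | C a => simp [← algebraMap_eq]
  | add p q hp hq => simp only [map_add, hp, hq, add_mul, Finset.sum_add_distrib]
  | mul_X p j hp =>
    have h : ∑ i, aeval (affineChart A) (pderiv i (X j : Poly3 K)) * pderiv k (affineChart A i) =
        pderiv k (affineChart A j) := by
      rw [Finset.sum_eq_single j]
      · simp
      · intro i _ hij
        simp [pderiv_X_of_ne hij.symm]
      · simp
    rw [map_mul, aeval_X, Derivation.leibniz, hp, smul_eq_mul, smul_eq_mul, ← h, Finset.mul_sum,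
      Finset.mul_sum, ← Finset.sum_add_distrib]
    refine Finset.sum_congr rfl fun i _ => ?_
    rw [Derivation.leibniz, smul_eq_mul, smul_eq_mul, map_add, map_mul, map_mul, aeval_X]
    ring

/-- The equation of special pairs, in an affine chart. -/
theorem kernelField_localFunction (A : GL (Fin 3) K) {F : Poly3 K} {ω : OneForm K} {c : K}
    (h : wedge11 (diff0 F) ω = F • (c • diff1 ω)) :
    kernelField (localForm A ω 0) (localForm A ω 1) (localFunction A F) =
      C c * localFunction A F *
        (pderiv 0 (localForm A ω 1) - pderiv 1 (localForm A ω 0)) := by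
  have hC : ∀ r : K, localFunction A (C r) = C r := fun r => by simp [localFunction, algebraMap_eq]
  have hmul : ∀ P Q, localFunction A (P * Q) = localFunction A P * localFunction A Q := map_mul _
  have hsub : ∀ P Q, localFunction A (P - Q) = localFunction A P - localFunction A Q := map_sub _
  have h0 := congrArg (localFunction A) (congrFun h 0)
  have h1 := congrArg (localFunction A) (congrFun h 1)
  have h2 := congrArg (localFunction A) (congrFun h 2)
  simp only [wedge11, diff1, Pi.smul_apply, smul_eq_mul, Matrix.cons_val_zero, smul_eq_C_mul,
    Matrix.cons_val_one, Matrix.cons_val, hmul, hsub, hC] at h0 h1 h2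
  rw [kernelField_apply, pderiv_localFunction, pderiv_localFunction]
  simp only [localForm_zero, localForm_one, map_add, pderiv_mul, pderiv_localFunction, pderiv_C,
    mul_zero, add_zero]
  simp only [diff0] at h0 h1 h2 ⊢
  -- The multipliers are the minors of the first two columns of `A`, that is, the pull-backs of
  -- `dy∧dz`, `dz∧dx`, `dx∧dy`.
  linear_combination (C (A 1 0) * C (A 2 1) - C (A 1 1) * C (A 2 0)) * h0 +
    (C (A 2 0) * C (A 0 1) - C (A 2 1) * C (A 0 0)) * h1 +
    (C (A 0 0) * C (A 1 1) - C (A 0 1) * C (A 1 0)) * h2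

end Charts

theorem IsSpecialPair.wedge_eq {K : Type*} [Field K] {d e : ℕ} {hd : ((d + 2 : ℕ) : K) ≠ 0}
    {F : PlaneFoliation K d} {C : PlaneCurve K e} (h : IsSpecialPair hd F C) :
    wedge11 (diff0 C.eqn) F.form =
      C.eqn • (((e : K) / ((d + 2 : ℕ) : K)) • diff1 F.form) := by
  obtain ⟨hC, hβ⟩ := h
  have h := (existsUnique_beta hd F C hC).choose_spec.1
  change wedge11 _ _ = C.eqn • (_ + radial3 (betaForm hd F C hC)) at h
  have h0 : radial3 (0 : ThreeForm K) = 0 := by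
    funext i
    simp [radial3]
  rwa [hβ, h0, add_zero] at h

theorem IsSpecialPair.hasMultiplicityAt_two {K : Type*} [Field K] (p : ℕ) [Fact p.Prime]
    [CharP K p] [PerfectRing K p] {d e : ℕ} {hd : ((d + 2 : ℕ) : K) ≠ 0} {F : PlaneFoliation K d}
    {C : PlaneCurve K e} (hspecial : IsSpecialPair hd F C) {q : Plane K}
    (hq : IsPReducedAt p F q) : C.HasMultiplicityAt q 2 := by
  obtain ⟨hsing, A, hA, α, hα, ha, hb⟩ := hq
  intro B hB
  rw [order_localFunction_eq hB hA C.isHomogeneous]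
  have hαp : α ^ p ≠ α := by
    rw [Ne, ← Subfield.mem_bot_iff_pow_eq_self, ← ZMod.fieldRange_castHom_eq_bot p]
    exact hα
  -- The linear part says nothing about constant terms; these vanish because `q` is singular.
  have hcoeff : ∀ k, constantCoeff (localForm A F.form k) = 0 := by
    intro k
    rw [localForm, map_sum]
    refine Finset.sum_eq_zero fun j _ => ?_
    rw [map_mul]
    exact mul_eq_zero_of_left ((constantCoeff_localFunction_eq_zero_iff hA
      (F.isHomogeneous j)).mpr (Set.mem_iInter.mp hsing j)) _
  have ha' : localForm A F.form 0 - MvPolynomial.C 1 * X 1 ∈ idealOfVars (Fin 2) K ^ 2 := by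
    refine sub_mem_idealOfVars_sq (by simp [hcoeff]) ?_
    rw [ha, map_one, one_mul]
    rw [homogeneousComponent_of_mem (isHomogeneous_X K (1 : Fin 2)), if_pos rfl]
  have hb' : localForm A F.form 1 - MvPolynomial.C α * X 0 ∈ idealOfVars (Fin 2) K ^ 2 := by
    refine sub_mem_idealOfVars_sq (by simp [hcoeff]) ?_
    rw [hb]
    rw [homogeneousComponent_of_mem (isHomogeneous_C_mul_X α (0 : Fin 2)), if_pos rfl]
  have hf := kernelField_localFunction A hspecial.wedge_eq
  have hsq := squarefree_localFunction A C.isHomogeneous C.reduced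
  have hcast : ∀ n : ℕ, (n : K) ^ p = n := map_natCast (frobenius K p)
  have hc : ((e : K) / ((d + 2 : ℕ) : K)) ^ p = (e : K) / ((d + 2 : ℕ) : K) := by
    rw [div_pow, hcast, hcast]
  -- What remains is to exclude `c = 0`, where `f` would be a first integral.
  refine order_eq_two_of_special p hαp ha' hb' hc (fun hc0 => ?_) hsq hf
  rw [hc0, map_zero, zero_mul, zero_mul] at hf
  have hΔ : pCurvature p (localForm A F.form 0) (localForm A F.form 1) ≠ 0 := fun h =>
    pCurvature_notMem p hαp ha' hb' (h ▸ Ideal.zero_mem _)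
  have he : 2 ≤ e := by
    have h : p ∣ e := (CharP.cast_eq_zero_iff K p e).mp ((div_eq_zero_iff.mp hc0).resolve_right hd)
    exact (Fact.out : p.Prime).two_le.trans (Nat.le_of_dvd C.deg_pos h)
  obtain ⟨i, hi⟩ := exists_pderiv_dehomogenize_ne_zero p
    (linearSubst_isHomogeneous A.val C.isHomogeneous) he (squarefree_linearSubst A C.reduced)
  rw [dehomogenize_linearSubst] at hi
  exact hi (pderiv_eq_zero_of_kernelField_eq_zero p hΔ hf i)

theorem mainTheorem10 {K : Type*} [Field K] [IsAlgClosed K] (p : ℕ) [Fact p.Prime] [CharP K p]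
    {d e : ℕ} (hd : 0 < d) (hpd : ((d + 2 : ℕ) : K) ≠ 0)
    (F : PlaneFoliation K d) (C : PlaneCurve K e)
    (hspecial : IsSpecialPair hpd F C)
    (hreduced : ∀ q ∈ F.sing, IsPReducedAt p F q) :
    F.sing ⊆ C.points ∧ ∀ q ∈ F.sing, C.HasMultiplicityAt q 2 := by
  have hmult : ∀ q ∈ F.sing, C.HasMultiplicityAt q 2 := fun q hq =>
    hspecial.hasMultiplicityAt_two p (hreduced q hq)
  refine ⟨fun q hq => ?_, hmult⟩
  obtain ⟨A, hA⟩ := exists_isCentredAt q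
  refine (constantCoeff_localFunction_eq_zero_iff hA C.isHomogeneous).mp ?_
  rw [← mem_idealOfVars_iff_constantCoeff, ← pow_one (idealOfVars (Fin 2) K),
    ← natCast_le_order_iff, hmult q hq A hA]
  norm_num
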